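/- Let $n\ge 1$ be an integer. Write $\Gamma$ for the (meromorphically continued) Gamma function, with the convention $1/\Gamma(s)=0$ for $s=0,-1,-2,\dots$, and put $$\gamma_n(\beta)=\frac{2^{\beta}\pi^{n/2}\,\Gamma(\beta/2)}{\Gamma((n-\beta)/2)}.$$ For $0<\alpha<n$, the Riesz potential of a function $f$ on $\mathbb R^n$ is $$(I^\alpha f)(x)=\frac1{\gamma_n(\alpha)}\int_{\mathbb R^n}\frac{f(y)\,dy}{|x-y|^{n-\alpha}} .$$ For an integer $m\ge 0$ and a real number $\alpha>0$, let $$w(x)=w_{\alpha,m}(x)=(-\Delta)^m\big[(1+|x|^2)^{m-(n+\alpha)/2}\big],\qquad x\in\mathbb R^n .$$ 1. For all $m$ and all $\alpha>0$, $w\in L^1(\mathbb R^n)$. 2. Suppose in addition that $\alpha<\min(n,2m)$, and let $h=I^\alpha w$. Then for every $x\in\mathbb R^n$ the integral defining $h(x)$ converges absolutely, and $$h(x)=a_{\alpha,m}\,(1+|x|^2)^{(\alpha-n)/2-m},\qquad a_{\alpha,m}=2^{2m-\alpha}\,\frac{\Gamma((n+2m-\alpha)/2)}{\Gamma((n+\alpha-2m)/2)}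 .$$ Moreover $h\in L^1(\mathbb R^n)$, and $$c_{\alpha,m}:=\int_{\mathbb R^n}h(x)\,dx=\frac{2^{2m-\alpha}\pi^{n/2}\,\Gamma(m-\alpha/2)}{\Gamma((n+\alpha-2m)/2)}=\gamma_n(2m-\alpha).$$ 3. If $0<\alpha<n$ and $\alpha$ is not an integer, then $c_{\alpha,m}\ne0$ for every integer $m>\alpha/2$. 4. If $\alpha\in\{1,2,\dots,n-1\}$ and $m=\lfloor(\alpha+2)/2\rfloor$, then $\alpha<2m$ and $c_{\alpha,m}\neq0$. -/

import Mathlib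

open MeasureTheory

namespace RieszInversion

noncomputable section

/-- `(1 + |x|²)^β` on `ℝⁿ`. -/
def bracketPow (n : ℕ) (β : ℝ) (x : EuclideanSpace ℝ (Fin n)) : ℝ :=
  (1 + ‖x‖ ^ 2) ^ β

/-- `(-Δ)^m f`, the `m`-fold iterate of minus the Laplacian on `ℝⁿ`. -/
def negLaplacianPow {n : ℕ} (m : ℕ) (f : EuclideanSpace ℝ (Fin n) → ℝ) :
    EuclideanSpace ℝ (Fin n) → ℝ :=
  (fun g : EuclideanSpace ℝ (Fin n) → ℝ => -Laplacian.laplacian g)^[m] f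

/-- The reconstructing function `w = (-Δ)^m [(1 + |x|²)^(m - (n + α)/2)]`. -/
def w (n m : ℕ) (α : ℝ) : EuclideanSpace ℝ (Fin n) → ℝ :=
  negLaplacianPow m (bracketPow n ((m : ℝ) - ((n : ℝ) + α) / 2))

/-- `γ_n(α) = 2^α π^(n/2) Γ(α/2) / Γ((n - α)/2)`. The reciprocal of the Gamma function is
extended, as usual, by the value `0` at the poles `0, -1, -2, …`; this is what the real division
gives, since `Real.Gamma` takes the value `0` there. -/
def gammaConst (n : ℕ) (α : ℝ) : ℝ :=
  2 ^ α * Real.pi ^ ((n : ℝ) / 2) * Real.Gamma (α / 2) / Real.Gamma (((n : ℝ) - α) / 2)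

/-- The Riesz integrand `y ↦ f(y) / |x - y|^(n - α)`. -/
def rieszIntegrand {n : ℕ} (α : ℝ) (f : EuclideanSpace ℝ (Fin n) → ℝ)
    (x y : EuclideanSpace ℝ (Fin n)) : ℝ :=
  f y / ‖x - y‖ ^ ((n : ℝ) - α)

/-- The Riesz potential `(I^α f)(x) = γ_n(α)⁻¹ ∫ f(y) / |x - y|^(n - α) dy`. -/
def rieszPotential {n : ℕ} (α : ℝ) (f : EuclideanSpace ℝ (Fin n) → ℝ)
    (x : EuclideanSpace ℝ (Fin n)) : ℝ :=
  1 / gammaConst n α * ∫ y, rieszIntegrand α f x y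

/-- `h = I^α w`. -/
def h (n m : ℕ) (α : ℝ) : EuclideanSpace ℝ (Fin n) → ℝ :=
  rieszPotential α (w n m α)

/-- `a_{α,m} = 2^(2m - α) Γ((n + 2m - α)/2) / Γ((n + α - 2m)/2)`, with `1/Γ` equal to `0` at the
poles of `Γ`. -/
def aConst (n m : ℕ) (α : ℝ) : ℝ :=
  2 ^ (2 * (m : ℝ) - α) * Real.Gamma (((n : ℝ) + 2 * m - α) / 2) /
    Real.Gamma (((n : ℝ) + α - 2 * m) / 2)

/-- `c_{α,m} = ∫ h(x) dx`. -/
def cConst (n m : ℕ) (α : ℝ) : ℝ :=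
  ∫ x, h n m α x

end

end RieszInversion

namespace RieszInversion

/-! With `r = 1 + |x|²` and `e_k = (s)_k r^(-s-k)`, where `(s)_k` is the rising factorial, one
application of the Laplacian gives `-Δ e_k = 4 (e_(k+2) - (q + k) e_(k+1))`, `q = s + 1 - n/2`.
Iterating, `w` is a finite combination of the powers `r^(-(n+α)/2 - j)`, `j ≤ m`, whose coefficients
contain `C(m,j) (-α/2)_(m-j)` (`w_eq_sum`). Each such power is integrable.

The Riesz integral of one such power is computed by subordination (`riesz_bracketPow`): both factors
of the integrand are written as Gamma integrals, the Gaussian integral in `y` is evaluated, and the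
substitution `v = ut/(u+t)` leaves elementary Gamma integrals. The result is a combination of `X_i =
Γ((n-α)/2 + i) r^(-(n-α)/2 - i)`, `i ≤ j`, with weights `C(j,i) (α/2)_(j-i)`.

The triangular matrices with entries `C(m,j) (-a)_(m-j)` and `C(j,i) (a)_(j-i)` are mutually inverse
by Chu-Vandermonde (`sum_rising_inversion`), so with `a = α/2` the potential of `w` collapses to a
multiple of `X_m`. Integrating this single power gives `c_{α,m}`, which can vanish only at a pole of
the Gamma function in the denominator. -/

variable {n : ℕ}

/-! ### The Laplacian of powers of `1 + |x|²`. -/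

theorem one_add_norm_sq_pos (x : EuclideanSpace ℝ (Fin n)) : 0 < 1 + ‖x‖ ^ 2 := by positivity

theorem contDiff_bracketPow (β : ℝ) : ContDiff ℝ 2 (bracketPow n β) :=
  (contDiff_const.add (contDiff_norm_sq ℝ)).rpow_const_of_ne
    fun x => (one_add_norm_sq_pos x).ne'

theorem hasFDerivAt_bracketPow (β : ℝ) (x : EuclideanSpace ℝ (Fin n)) :
    HasFDerivAt (bracketPow n β) ((2 * β * bracketPow n (β - 1) x) • innerSL ℝ x) x := by
  have h1 : HasFDerivAt (fun y : EuclideanSpace ℝ (Fin n) => 1 + ‖y‖ ^ 2)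
      (2 • innerSL ℝ x) x := (hasStrictFDerivAt_norm_sq x).hasFDerivAt.const_add 1
  convert! h1.rpow_const (p := β) (Or.inl (one_add_norm_sq_pos x).ne') using 1
  ext v
  simp [bracketPow]
  ring

theorem fderiv_bracketPow (β : ℝ) :
    fderiv ℝ (bracketPow n β) = fun x => (2 * β * bracketPow n (β - 1) x) • innerSL ℝ x :=
  funext fun x => (hasFDerivAt_bracketPow β x).fderiv

theorem iteratedFDeriv_two_bracketPow (β : ℝ) (x v : EuclideanSpace ℝ (Fin n)) :
    iteratedFDeriv ℝ 2 (bracketPow n β) x ![v, v] =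
      2 * β * bracketPow n (β - 1) x * ‖v‖ ^ 2 +
        4 * β * (β - 1) * bracketPow n (β - 2) x * inner ℝ x v ^ 2 := by
  rw [iteratedFDeriv_two_apply, fderiv_bracketPow]
  have h1 := ((hasFDerivAt_bracketPow (β - 1) x).const_mul (2 * β)).smul
    (innerSL ℝ (E := EuclideanSpace ℝ (Fin n))).hasFDerivAt
  have h3 := h1.fderiv
  change fderiv ℝ (fun y => (2 * β * bracketPow n (β - 1) y) • innerSL ℝ y) x = _ at h3
  rw [h3]
  have h2 : β - 1 - 1 = β - 2 := by ring
  have h4 : (innerSL ℝ v) v = ‖v‖ ^ 2 := real_inner_self_eq_norm_sq v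
  have h5 : (innerSL ℝ x) v = inner ℝ x v := rfl
  change (2 * β * bracketPow n (β - 1) x) * (innerSL ℝ v) v +
    (2 * β * (2 * (β - 1) * bracketPow n (β - 1 - 1) x * (innerSL ℝ x) v)) *
      (innerSL ℝ x) v = _
  rw [h2, h4, h5]
  ring

theorem bracketPow_add_one (β : ℝ) (x : EuclideanSpace ℝ (Fin n)) :
    bracketPow n (β + 1) x = (1 + ‖x‖ ^ 2) * bracketPow n β x := by
  rw [bracketPow, Real.rpow_add_one (one_add_norm_sq_pos x).ne', mul_comm, bracketPow]

/-- The trace of the Hessian in an orthonormal basis produces `n` and `|x|²`; writing `|x|² = (1 +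
|x|²) - 1` keeps the result within powers of `1 + |x|²`. -/
theorem laplacian_bracketPow (β : ℝ) (x : EuclideanSpace ℝ (Fin n)) :
    Laplacian.laplacian (bracketPow n β) x =
      2 * β * (n + 2 * β - 2) * bracketPow n (β - 1) x -
        4 * β * (β - 1) * bracketPow n (β - 2) x := by
  let b := EuclideanSpace.basisFun (Fin n) ℝ
  rw [InnerProductSpace.laplacian_eq_iteratedFDeriv_orthonormalBasis _ b]
  simp only [iteratedFDeriv_two_bracketPow, Finset.sum_add_distrib, ← Finset.mul_sum]
  have h1 : ∑ i, inner ℝ x (b i) ^ 2 = ‖x‖ ^ 2 := by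
    rw [← b.sum_sq_norm_inner_left]
    simp
  have h2 : ∑ i, ‖b i‖ ^ 2 = (n : ℝ) := by simp
  have h3 := bracketPow_add_one (β - 2) x
  rw [show β - 2 + 1 = β - 1 by ring] at h3
  rw [h1, h2, h3]
  ring

theorem contDiff_sum_bracketPow {ι : Type*} (s : Finset ι) (c β : ι → ℝ) :
    ContDiff ℝ 2 fun x => ∑ j ∈ s, c j * bracketPow n (β j) x :=
  ContDiff.sum fun j _ => contDiff_const.mul (contDiff_bracketPow (β j))

theorem laplacian_sum_bracketPow {ι : Type*} (s : Finset ι) (c β : ι → ℝ)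
    (x : EuclideanSpace ℝ (Fin n)) :
    Laplacian.laplacian (fun x => ∑ j ∈ s, c j * bracketPow n (β j) x) x =
      ∑ j ∈ s, c j * Laplacian.laplacian (bracketPow n (β j)) x := by
  classical
  induction s using Finset.induction_on with
  | empty => simp
  | insert a s ha ih =>
    simp only [Finset.sum_insert ha]
    rw [← ih]
    have h1 := (contDiff_const (c := c a)).mul (contDiff_bracketPow (n := n) (β a))
    have h2 := contDiff_sum_bracketPow (n := n) s c β
    refine (h1.contDiffAt.laplacian_add h2.contDiffAt).trans ?_
    congr 1
    exact InnerProductSpace.laplacian_smul (c a) (contDiff_bracketPow (β a)).contDiffAt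

/-! ### Rising factorials and the iterated Laplacian. -/

/-- The rising factorial `x (x + 1) ⋯ (x + k - 1)`. -/
noncomputable def rising (x : ℝ) (k : ℕ) : ℝ := (ascPochhammer ℝ k).eval x

@[simp] theorem rising_zero (x : ℝ) : rising x 0 = 1 := by simp [rising]

theorem rising_succ (x : ℝ) (k : ℕ) : rising x (k + 1) = rising x k * (x + k) :=
  ascPochhammer_succ_eval k x

theorem rising_succ_left (x : ℝ) (k : ℕ) : rising x (k + 1) = x * rising (x + 1) k := by
  simp [rising, ascPochhammer_succ_left, Polynomial.eval_comp]

theorem rising_add (x : ℝ) (j k : ℕ) : rising x (j + k) = rising x j * rising (x + j) k := by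
  induction k with
  | zero => simp
  | succ k ih => rw [← add_assoc, rising_succ, ih, rising_succ]; push_cast; ring

theorem neg_one_pow_mul_rising (x : ℝ) (k : ℕ) :
    (-1) ^ k * rising x k = rising (1 - x - k) k := by
  induction k with
  | zero => simp
  | succ k ih =>
    rw [rising_succ_left (1 - x - _), rising_succ, pow_succ]
    have h1 : 1 - x - ((k + 1 : ℕ) : ℝ) + 1 = 1 - x - k := by push_cast; ring
    rw [h1, ← ih]
    push_cast
    ring

/-- The coefficients in the expansion of the iterated Laplacian of `(1 + |x|²)^(-s)`, where
`q = s + 1 - n / 2`. -/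
noncomputable def laplacianCoeff (q : ℝ) (m j : ℕ) : ℝ :=
  m.choose j * ((-1) ^ (m - j) * rising (q + j) (m - j))

theorem laplacianCoeff_succ_zero (q : ℝ) (m : ℕ) :
    laplacianCoeff q (m + 1) 0 = -(q + m) * laplacianCoeff q m 0 := by
  simp [laplacianCoeff, rising_succ, pow_succ]
  ring

/-- For `m = j + k + 1` every term is a multiple of `(-1)^k (q + j + 1)_k`, and what remains is `(j
+ 1) C(m, j + 1) = (k + 1) C(m, j)`. -/
theorem laplacianCoeff_succ_succ (q : ℝ) (m j : ℕ) (hj : j ≤ m) :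
    laplacianCoeff q (m + 1) (j + 1) =
      -(q + m + (j + 1)) * laplacianCoeff q m (j + 1) + laplacianCoeff q m j := by
  rcases hj.eq_or_lt with rfl | hj
  · simp [laplacianCoeff]
  · obtain ⟨k, rfl⟩ := Nat.exists_eq_add_of_lt hj
    have h1 : j + k + 1 - j = k + 1 := by omega
    have h2 : j + k + 1 + 1 - (j + 1) = k + 1 := by omega
    have h3 : j + k + 1 - (j + 1) = k := by omega
    have h4 := Nat.choose_succ_right_eq (j + k + 1) j
    rw [h1] at h4
    have h5 : ((j + k + 1).choose (j + 1) : ℝ) * (j + 1) = (j + k + 1).choose j * (k + 1) := by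
      exact_mod_cast h4
    simp only [laplacianCoeff, h1, h2, h3, Nat.choose_succ_succ (j + k + 1) j]
    rw [rising_succ_left (q + j), rising_succ]
    push_cast
    rw [← add_assoc q]
    linear_combination (-1) ^ k * rising (q + j + 1) k * h5

theorem laplacianCoeff_of_lt (q : ℝ) {m j : ℕ} (hj : m < j) : laplacianCoeff q m j = 0 := by
  simp [laplacianCoeff, Nat.choose_eq_zero_of_lt hj]

theorem negLaplacianPow_succ (m : ℕ) (f : EuclideanSpace ℝ (Fin n) → ℝ) :
    negLaplacianPow (m + 1) f = -Laplacian.laplacian (negLaplacianPow m f) :=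
  Function.iterate_succ_apply' _ _ _

/-- Iterates of `-Δ` on `(1 + |x|²)^(-s)`, in terms of the functions
`(s)_k (1 + |x|²)^(-s - k)`. -/
theorem negLaplacianPow_bracketPow (s : ℝ) (m : ℕ) :
    negLaplacianPow m (bracketPow n (-s)) = fun x => ∑ j ∈ Finset.range (m + 1),
      4 ^ m * laplacianCoeff (s + 1 - n / 2) m j * rising s (m + j) *
        bracketPow n (-s - (m + j)) x := by
  induction m with
  | zero => ext x; simp [negLaplacianPow, laplacianCoeff]
  | succ m ih =>
    ext x
    set q := s + 1 - n / 2 with hq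
    rw [negLaplacianPow_succ, ih, Pi.neg_apply, laplacian_sum_bracketPow, ← Finset.sum_neg_distrib]
    -- In this normalisation `-Δ e_k = 4 (e_(k+2) - (q + k) e_(k+1))`: the factor `s` enters only
    -- through `q`, and the induction becomes a recursion on coefficients.
    set e : ℕ → ℝ := fun k => rising s k * bracketPow n (-s - k) x with he
    have h1 : ∀ j ∈ Finset.range (m + 1),
        -(4 ^ m * laplacianCoeff q m j * rising s (m + j) *
          Laplacian.laplacian (bracketPow n (-s - (m + j))) x) =
        4 ^ (m + 1) * (-(q + m + j) * laplacianCoeff q m j * e (m + 1 + j)) +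
          4 ^ (m + 1) * (laplacianCoeff q m j * e (m + 1 + (j + 1))) := by
      intro j _
      have h3 : m + 1 + j = m + j + 1 := by omega
      have h4 : m + 1 + (j + 1) = m + j + 1 + 1 := by omega
      have h5 : -s - (m + j) - 1 = -s - ((m + j + 1 : ℕ) : ℝ) := by push_cast; ring
      have h6 : -s - (m + j) - 2 = -s - ((m + j + 1 + 1 : ℕ) : ℝ) := by push_cast; ring
      rw [laplacian_bracketPow, h3, h4, h5, h6]
      simp only [he, rising_succ, hq]
      push_cast
      ring
    have h2 : ∀ j ∈ Finset.range (m + 1 + 1),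
        4 ^ (m + 1) * laplacianCoeff q (m + 1) j * rising s (m + 1 + j) *
          bracketPow n (-s - ((m + 1 : ℕ) + j)) x =
        4 ^ (m + 1) * (laplacianCoeff q (m + 1) j * e (m + 1 + j)) := by
      intro j _
      simp only [he]
      push_cast
      ring
    rw [Finset.sum_congr rfl h1, Finset.sum_congr rfl h2, Finset.sum_add_distrib,
      Finset.sum_range_succ' _ (m + 1)]
    have h3 : ∀ j ∈ Finset.range (m + 1),
        4 ^ (m + 1) * (laplacianCoeff q (m + 1) (j + 1) * e (m + 1 + (j + 1))) =
        4 ^ (m + 1) * (-(q + m + (j + 1 : ℕ)) * laplacianCoeff q m (j + 1) *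
          e (m + 1 + (j + 1))) +
          4 ^ (m + 1) * (laplacianCoeff q m j * e (m + 1 + (j + 1))) := by
      intro j hj
      rw [laplacianCoeff_succ_succ q m j (Nat.lt_succ_iff.mp (Finset.mem_range.mp hj))]
      push_cast
      ring
    have h4 : ∑ j ∈ Finset.range (m + 1),
        4 ^ (m + 1) * (-(q + m + j) * laplacianCoeff q m j * e (m + 1 + j)) =
        ∑ j ∈ Finset.range (m + 1), 4 ^ (m + 1) * (-(q + m + (j + 1 : ℕ)) *
          laplacianCoeff q m (j + 1) * e (m + 1 + (j + 1))) +
        4 ^ (m + 1) * (laplacianCoeff q (m + 1) 0 * e (m + 1 + 0)) := by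
      rw [Finset.sum_range_succ', Finset.sum_range_succ _ m,
        laplacianCoeff_of_lt q (Nat.lt_succ_self m), laplacianCoeff_succ_zero]
      simp
    rw [Finset.sum_congr rfl h3, Finset.sum_add_distrib, h4]
    ring

/-! ### Expansion and integrability of `w`. -/

theorem bracketPow_integrable {β : ℝ} (hβ : β < -(n / 2 : ℝ)) :
    Integrable (bracketPow n β) volume := by
  have h1 := integrable_rpow_neg_one_add_norm_sq (E := EuclideanSpace ℝ (Fin n))
    (μ := volume) (r := -2 * β) (by simp; linarith)
  rwa [show -(-2 * β) / 2 = β by ring] at h1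

/-- The coefficient of `(1 + |x|²)^(-(n + α)/2 - j)` in `w`. -/
noncomputable def wCoeff (n m : ℕ) (α : ℝ) (j : ℕ) : ℝ :=
  4 ^ m * (m.choose j * rising (-(α / 2)) (m - j)) * rising ((n + α) / 2 - m) (m + j)

theorem w_eq_sum (m : ℕ) (α : ℝ) : w n m α = fun x => ∑ j ∈ Finset.range (m + 1),
    wCoeff n m α j * bracketPow n (-((n + α) / 2 + j)) x := by
  have h1 : (m : ℝ) - (n + α) / 2 = -((n + α) / 2 - m) := by ring
  rw [w, h1, negLaplacianPow_bracketPow]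
  ext x
  refine Finset.sum_congr rfl fun j hj => ?_
  have hj' : j ≤ m := Nat.lt_succ_iff.mp (Finset.mem_range.mp hj)
  -- For `s = (n + α)/2 - m` one has `q = α/2 - m + 1`, so reflecting the rising factorial turns its
  -- base `q + j` into `-α/2`, independent of `j`.
  rw [wCoeff, laplacianCoeff, neg_one_pow_mul_rising, Nat.cast_sub hj']
  congr 3
  · congr 3
    ring
  · ring

theorem w_integrable (m : ℕ) {α : ℝ} (hα : 0 < α) : Integrable (w n m α) volume := by
  rw [w_eq_sum]
  refine integrable_finsetSum _ fun j _ => (bracketPow_integrable ?_).const_mul _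
  have : (0 : ℝ) ≤ j := j.cast_nonneg
  linarith

/-! ### Chu-Vandermonde and inversion of the binomial transform. -/

/-- The Chu-Vandermonde identity for rising factorials. -/
theorem sum_choose_mul_rising (x y : ℝ) (k : ℕ) :
    ∑ ij ∈ Finset.HasAntidiagonal.antidiagonal k, (k.choose ij.1 : ℝ) * (rising x ij.1 * rising y ij.2) =
      rising (x + y) k := by
  induction k with
  | zero => simp
  | succ k ih =>
    rw [Finset.sum_antidiagonal_choose_succ_mul fun i j => rising x i * rising y j,
      ← Finset.sum_add_distrib, rising_succ, ← ih, Finset.sum_mul]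
    refine Finset.sum_congr rfl fun ij hij => ?_
    have h1 : ij.1 + ij.2 = k := Finset.HasAntidiagonal.mem_antidiagonal.mp hij
    rw [← Nat.choose_symm_of_eq_add h1.symm, rising_succ, rising_succ, ← h1]
    push_cast
    ring

theorem rising_zero_left {k : ℕ} (hk : k ≠ 0) : rising 0 k = 0 := by
  obtain ⟨k, rfl⟩ := Nat.exists_eq_succ_of_ne_zero hk
  rw [rising_succ_left, zero_mul]

/-- After exchanging the sums, the coefficient of `X i` is `C(m,i) (a - a)_(m-i)` by
Chu-Vandermonde, which vanishes unless `i = m`. -/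
theorem sum_rising_inversion (a : ℝ) (X : ℕ → ℝ) (m : ℕ) :
    ∑ j ∈ Finset.range (m + 1), (m.choose j * rising (-a) (m - j)) *
      ∑ i ∈ Finset.range (j + 1), (j.choose i * rising a (j - i)) * X i = X m := by
  have h1 : ∀ i ∈ Finset.range (m + 1), ∑ j ∈ Finset.Ico i (m + 1),
      (m.choose j * rising (-a) (m - j)) * ((j.choose i * rising a (j - i)) * X i) =
      m.choose i * rising 0 (m - i) * X i := by
    intro i hi
    have hi' : i ≤ m := Nat.lt_succ_iff.mp (Finset.mem_range.mp hi)
    rw [Finset.sum_Ico_eq_sum_range, Nat.sub_add_comm hi', ← add_neg_cancel a,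
      ← sum_choose_mul_rising, Finset.Nat.sum_antidiagonal_eq_sum_range_succ
        fun k l => ((m - i).choose k : ℝ) * (rising a k * rising (-a) l),
      Finset.mul_sum, Finset.sum_mul]
    refine Finset.sum_congr rfl fun l _ => ?_
    have h2 : (m.choose (i + l) : ℝ) * (i + l).choose i = m.choose i * (m - i).choose l := by
      have := Nat.choose_mul (n := m) (Nat.le_add_right i l)
      rw [Nat.add_sub_cancel_left] at this
      exact_mod_cast this
    rw [Nat.add_sub_cancel_left, Nat.sub_add_eq]
    linear_combination rising (-a) (m - i - l) * rising a l * X i * h2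
  simp_rw [Finset.mul_sum, Finset.range_eq_Ico]
  rw [← Finset.sum_Ico_Ico_comm, ← Finset.range_eq_Ico, Finset.sum_congr rfl h1,
    Finset.sum_range_succ, Finset.sum_eq_zero]
  · simp
  · intro i hi
    rw [rising_zero_left (Nat.sub_ne_zero_of_lt (Finset.mem_range.mp hi))]
    ring

/-- Valid for every real `s`, poles included; this is what lets `1/Γ((n + α)/2 - m)` be used without
excluding exceptional values. -/
theorem rising_div_Gamma (s : ℝ) (k : ℕ) :
    rising s k / Real.Gamma (s + k) = 1 / Real.Gamma s := by
  induction k with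
  | zero => simp
  | succ k ih =>
    rw [← ih, rising_succ]
    push_cast
    rw [← add_assoc]
    -- Here the left side vanishes through the factor `s + k`, the right side because `Real.Gamma 0
    -- = 0` and division by zero gives zero.
    by_cases h1 : s + k = 0
    · simp [h1]
    · rw [Real.Gamma_add_one h1]
      field_simp

/-! ### Gamma and Gaussian integrals. -/

theorem lintegral_rpow_mul_exp_neg_mul {a r : ℝ} (ha : 0 < a) (hr : 0 < r) :
    ∫⁻ t in Set.Ioi (0 : ℝ), ENNReal.ofReal (t ^ (a - 1) * Real.exp (-(r * t))) =
      ENNReal.ofReal (Real.Gamma a * r ^ (-a)) := by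
  have h1 := Real.integral_rpow_mul_exp_neg_mul_Ioi ha hr
  have h2 : 0 < Real.Gamma a := Real.Gamma_pos_of_pos ha
  rw [← ofReal_integral_eq_lintegral_ofReal, h1, one_div, Real.inv_rpow hr.le,
    Real.rpow_neg hr.le, mul_comm]
  -- A non-integrable function would have Bochner integral `0`, but the known value is positive.
  · refine not_imp_comm.1 integral_undef ?_
    rw [h1]
    positivity
  · filter_upwards [ae_restrict_mem measurableSet_Ioi] with t ht
    have : 0 < t := ht
    positivity

theorem lintegral_exp_neg_mul_norm_sub_sq {c : ℝ} (hc : 0 < c) (z : EuclideanSpace ℝ (Fin n)) :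
    ∫⁻ y, ENNReal.ofReal (Real.exp (-(c * ‖y - z‖ ^ 2))) =
      ENNReal.ofReal ((Real.pi / c) ^ ((n : ℝ) / 2)) := by
  rw [lintegral_sub_right_eq_self
    (fun y : EuclideanSpace ℝ (Fin n) => ENNReal.ofReal (Real.exp (-(c * ‖y‖ ^ 2)))) z]
  have h1 := GaussianFourier.integral_rexp_neg_mul_sq_norm (V := EuclideanSpace ℝ (Fin n)) hc
  simp only [neg_mul, finrank_euclideanSpace, Fintype.card_fin] at h1
  rw [← ofReal_integral_eq_lintegral_ofReal, h1]
  · refine not_imp_comm.1 integral_undef ?_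
    rw [h1]
    have := Real.pi_pos
    positivity
  · exact Filter.Eventually.of_forall fun y => (Real.exp_pos _).le

/-- Completing the square in `y`. -/
theorem add_mul_norm_sq_eq {u t : ℝ} (hut : 0 < u + t) (x y : EuclideanSpace ℝ (Fin n)) :
    u * ‖x - y‖ ^ 2 + t * ‖y‖ ^ 2 =
      (u + t) * ‖y - (u / (u + t)) • x‖ ^ 2 + u * t / (u + t) * ‖x‖ ^ 2 := by
  rw [norm_sub_sq_real, norm_sub_sq_real, real_inner_smul_right, norm_smul, mul_pow,
    Real.norm_eq_abs, sq_abs, real_inner_comm x y]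
  field_simp
  ring

theorem lintegral_gaussian_conv {u t : ℝ} (hu : 0 < u) (ht : 0 < t)
    (x : EuclideanSpace ℝ (Fin n)) :
    ∫⁻ y, ENNReal.ofReal (Real.exp (-(u * ‖x - y‖ ^ 2 + t * ‖y‖ ^ 2))) =
      ENNReal.ofReal (Real.exp (-(u * t / (u + t) * ‖x‖ ^ 2)) *
        (Real.pi / (u + t)) ^ ((n : ℝ) / 2)) := by
  have hut : 0 < u + t := add_pos hu ht
  rw [ENNReal.ofReal_mul (Real.exp_pos _).le,
    ← lintegral_exp_neg_mul_norm_sub_sq hut ((u / (u + t)) • x), ← lintegral_const_mul']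
  · refine lintegral_congr fun y => ?_
    rw [← ENNReal.ofReal_mul (Real.exp_pos _).le, ← Real.exp_add, add_mul_norm_sq_eq hut]
    congr 2
    ring
  · exact ENNReal.ofReal_ne_top

/-! ### The substitution `v = ut/(u+t)` and the resulting one-dimensional integrals. -/

theorem image_mul_div_sub {t : ℝ} (ht : 0 < t) :
    (fun v : ℝ => v * t / (t - v)) '' Set.Ioo 0 t = Set.Ioi 0 := by
  ext u
  simp only [Set.mem_image, Set.mem_Ioo, Set.mem_Ioi]
  constructor
  · rintro ⟨v, ⟨h1, h2⟩, rfl⟩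
    have := sub_pos.2 h2
    positivity
  · intro hu
    have h1 : 0 < u + t := add_pos hu ht
    refine ⟨u * t / (u + t), ⟨by positivity, ?_⟩, ?_⟩
    · rw [div_lt_iff₀ h1]
      nlinarith
    · have h2 : t - u * t / (u + t) = t ^ 2 / (u + t) := by field_simp; ring
      rw [h2]
      field_simp

theorem injOn_mul_div_sub {t : ℝ} (ht : 0 < t) :
    Set.InjOn (fun v : ℝ => v * t / (t - v)) (Set.Ioo 0 t) := by
  rintro v ⟨_, hv⟩ w ⟨_, hw⟩ h
  have h1 : t - v ≠ 0 := (sub_pos.2 hv).ne'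
  have h2 : t - w ≠ 0 := (sub_pos.2 hw).ne'
  simp only [div_eq_div_iff h1 h2] at h
  have h3 : t ^ 2 * v = t ^ 2 * w := by linear_combination h
  exact mul_left_cancel₀ (by positivity) h3

theorem hasDerivAt_mul_div_sub {t v : ℝ} (hv : v < t) :
    HasDerivAt (fun v : ℝ => v * t / (t - v)) (t ^ 2 / (t - v) ^ 2) v := by
  have h1 : t - v ≠ 0 := (sub_pos.2 hv).ne'
  convert! ((hasDerivAt_id v).mul_const t).div ((hasDerivAt_id v).const_sub t) h1 using 1
  simp
  ring

theorem rpow_mul_div_sub_identity {a b t v : ℝ} (hv : 0 < v) (hvt : v < t) :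
    t ^ 2 / (t - v) ^ 2 * ((v * t / (t - v)) ^ (b - 1) *
      (v * t / (t - v) + t) ^ (-(a + b))) =
      v ^ (b - 1) * t ^ (1 - b - 2 * a) * (t - v) ^ (a - 1) := by
  have h0 : 0 < t - v := sub_pos.2 hvt
  have ht : 0 < t := hv.trans hvt
  have h1 : v * t / (t - v) + t = t * t / (t - v) := by field_simp; ring
  have h2 : t ^ 2 / (t - v) ^ 2 = Real.exp (2 * Real.log t - 2 * Real.log (t - v)) := by
    rw [Real.exp_sub, two_mul, two_mul, Real.exp_add, Real.exp_add, Real.exp_log ht,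
      Real.exp_log h0]
    ring
  rw [h1, h2, Real.rpow_def_of_pos (by positivity), Real.rpow_def_of_pos (by positivity),
    Real.rpow_def_of_pos hv, Real.rpow_def_of_pos ht, Real.rpow_def_of_pos h0,
    Real.log_div (by positivity) h0.ne', Real.log_div (by positivity) h0.ne',
    Real.log_mul hv.ne' ht.ne', Real.log_mul ht.ne' ht.ne']
  simp only [← Real.exp_add]
  congr 1
  ring

/-- The substitution makes the exponent linear in the new variable; the power of `u + t = t²/(t -
v)` and the Jacobian `t²/(t - v)²` combine into pure powers of `t` and `t - v`. -/
theorem lintegral_mul_div_sub {a b R t : ℝ} (ht : 0 < t) :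
    ∫⁻ u in Set.Ioi (0 : ℝ), ENNReal.ofReal (u ^ (b - 1) * (u + t) ^ (-(a + b)) *
        Real.exp (-(u * t / (u + t) * R))) =
      ∫⁻ v in Set.Ioo 0 t, ENNReal.ofReal (v ^ (b - 1) * t ^ (1 - b - 2 * a) *
        (t - v) ^ (a - 1) * Real.exp (-(v * R))) := by
  rw [← image_mul_div_sub ht, lintegral_image_eq_lintegral_abs_deriv_mul measurableSet_Ioo
    (fun v hv => (hasDerivAt_mul_div_sub hv.2).hasDerivWithinAt) (injOn_mul_div_sub ht)]
  refine setLIntegral_congr_fun measurableSet_Ioo fun v hv => ?_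
  obtain ⟨hv, hvt⟩ := hv
  have h0 : 0 < t - v := sub_pos.2 hvt
  have h1 : v * t / (t - v) * t / (v * t / (t - v) + t) = v := by
    have h1 : v * t / (t - v) + t = t * t / (t - v) := by field_simp; ring
    rw [h1]
    field_simp
  rw [abs_of_nonneg (by positivity), ← ENNReal.ofReal_mul (by positivity), h1, ← mul_assoc,
    rpow_mul_div_sub_identity hv hvt]

theorem Gamma_add_nat {a : ℝ} (ha : 0 < a) (k : ℕ) :
    Real.Gamma (a + k) = rising a k * Real.Gamma a := by
  induction k with
  | zero => simp
  | succ k ih =>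
    push_cast
    rw [← add_assoc, Real.Gamma_add_one (by positivity), ih, rising_succ]
    ring

theorem rising_pos {a : ℝ} (ha : 0 < a) (k : ℕ) : 0 < rising a k := by
  induction k with
  | zero => simp
  | succ k ih => rw [rising_succ]; positivity

/-- Shift `t` by `v` and expand `(t + v)^j`; each term is a Gamma integral with `Γ(a + j - i) =
(a)_(j-i) Γ(a)`, the source of the binomial weights. -/
theorem lintegral_pow_mul_exp_mul_sub_rpow {a v : ℝ} (ha : 0 < a) (hv : 0 < v) (j : ℕ) :
    ∫⁻ t in Set.Ioi v, ENNReal.ofReal (t ^ j * (t - v) ^ (a - 1) * Real.exp (-t)) =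
      ENNReal.ofReal (∑ i ∈ Finset.range (j + 1), j.choose i * rising a (j - i) *
        Real.Gamma a * (v ^ i * Real.exp (-v))) := by
  have h1 : ∫⁻ t in Set.Ioi v, ENNReal.ofReal (t ^ j * (t - v) ^ (a - 1) * Real.exp (-t)) =
      ∫⁻ t in Set.Ioi (0 : ℝ),
        ENNReal.ofReal ((t + v) ^ j * t ^ (a - 1) * Real.exp (-(t + v))) := by
    rw [← lintegral_indicator measurableSet_Ioi, ← lintegral_indicator measurableSet_Ioi,
      ← lintegral_add_right_eq_self _ v]
    refine lintegral_congr fun t => ?_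
    simp [Set.indicator_apply]
  have h2 : ∀ t ∈ Set.Ioi (0 : ℝ),
      ENNReal.ofReal ((t + v) ^ j * t ^ (a - 1) * Real.exp (-(t + v))) =
      ∑ i ∈ Finset.range (j + 1), ENNReal.ofReal (j.choose i * (v ^ i * Real.exp (-v))) *
        ENNReal.ofReal (t ^ (a + (j - i : ℕ) - 1) * Real.exp (-(1 * t))) := by
    intro t ht
    have ht : 0 < t := ht
    simp only [← ENNReal.ofReal_mul (show
      0 ≤ (j.choose _ : ℝ) * (v ^ _ * Real.exp (-v)) by positivity)]
    rw [← ENNReal.ofReal_sum_of_nonneg (fun i _ => by positivity), add_comm t v, add_pow,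
      Finset.sum_mul, Finset.sum_mul]
    congr 1
    refine Finset.sum_congr rfl fun i _ => ?_
    rw [add_sub_right_comm, Real.rpow_add_natCast ht.ne', neg_add, Real.exp_add, one_mul]
    ring
  have h3 : 0 < Real.Gamma a := Real.Gamma_pos_of_pos ha
  have h4 : ∀ i, 0 < rising a i := rising_pos ha
  rw [h1, setLIntegral_congr_fun measurableSet_Ioi h2, lintegral_finsetSum _ (by fun_prop),
    ENNReal.ofReal_sum_of_nonneg fun i _ => by have := h4 (j - i); positivity]
  refine Finset.sum_congr rfl fun i _ => ?_
  rw [lintegral_const_mul _ (by fun_prop),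
    lintegral_rpow_mul_exp_neg_mul (by positivity) one_pos, ← ENNReal.ofReal_mul (by positivity),
    Gamma_add_nat ha, Real.one_rpow]
  congr 1
  ring

theorem lintegral_sum_pow_mul_exp {b R : ℝ} (hb : 0 < b) (hR : 0 ≤ R) (j : ℕ) (c : ℕ → ℝ)
    (hc : ∀ i, 0 ≤ c i) :
    ∫⁻ v in Set.Ioi (0 : ℝ), ENNReal.ofReal (v ^ (b - 1) * Real.exp (-(v * R)) *
        ∑ i ∈ Finset.range (j + 1), c i * (v ^ i * Real.exp (-v))) =
      ENNReal.ofReal (∑ i ∈ Finset.range (j + 1), c i *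
        (Real.Gamma (b + i) * (1 + R) ^ (-(b + i)))) := by
  have h2 : ∀ v ∈ Set.Ioi (0 : ℝ),
      ENNReal.ofReal (v ^ (b - 1) * Real.exp (-(v * R)) *
        ∑ i ∈ Finset.range (j + 1), c i * (v ^ i * Real.exp (-v))) =
      ∑ i ∈ Finset.range (j + 1), ENNReal.ofReal (c i) *
        ENNReal.ofReal (v ^ (b + i - 1) * Real.exp (-((1 + R) * v))) := by
    intro v hv
    have hv : 0 < v := hv
    simp only [← ENNReal.ofReal_mul (hc _)]
    rw [← ENNReal.ofReal_sum_of_nonneg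
      (fun i _ => mul_nonneg (hc i) (by positivity)), Finset.mul_sum]
    congr 1
    refine Finset.sum_congr rfl fun i _ => ?_
    rw [add_sub_right_comm, Real.rpow_add_natCast hv.ne', one_add_mul, neg_add, Real.exp_add,
      mul_comm R v]
    ring
  rw [setLIntegral_congr_fun measurableSet_Ioi h2, lintegral_finsetSum _ (by fun_prop),
    ENNReal.ofReal_sum_of_nonneg fun i _ => mul_nonneg (hc i)
      (mul_nonneg (Real.Gamma_pos_of_pos (by positivity)).le (by positivity))]
  refine Finset.sum_congr rfl fun i _ => ?_
  rw [lintegral_const_mul _ (by fun_prop),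
    lintegral_rpow_mul_exp_neg_mul (by positivity) (by positivity), ← ENNReal.ofReal_mul (hc i)]

/-- Tonelli on the triangle `0 < v < t`. -/
theorem lintegral_Ioi_Ioo_swap {f : ℝ → ℝ → ENNReal} (hf : Measurable (Function.uncurry f)) :
    ∫⁻ t in Set.Ioi (0 : ℝ), ∫⁻ v in Set.Ioo 0 t, f t v =
      ∫⁻ v in Set.Ioi (0 : ℝ), ∫⁻ t in Set.Ioi v, f t v := by
  have hs : MeasurableSet {p : ℝ × ℝ | 0 < p.2 ∧ p.2 < p.1} :=
    (measurableSet_lt measurable_const measurable_snd).inter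
      (measurableSet_lt measurable_snd measurable_fst)
  have h1 : ∀ t v, Set.indicator (Set.Ioi 0) (fun t => Set.indicator (Set.Ioo 0 t) (f t) v) t =
      Set.indicator {p : ℝ × ℝ | 0 < p.2 ∧ p.2 < p.1} (Function.uncurry f) (t, v) := by
    intro t v
    simp only [Set.indicator_apply, Set.mem_Ioi, Set.mem_Ioo, Set.mem_ofPred_eq, Function.uncurry]
    grind
  have h2 : ∀ t v, Set.indicator (Set.Ioi 0) (fun v => Set.indicator (Set.Ioi v) (f · v) t) v =
      Set.indicator {p : ℝ × ℝ | 0 < p.2 ∧ p.2 < p.1} (Function.uncurry f) (t, v) := by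
    intro t v
    simp only [Set.indicator_apply, Set.mem_Ioi, Set.mem_ofPred_eq, Function.uncurry]
    grind
  have h3 : ∀ t, Set.indicator (Set.Ioi 0) (fun t => ∫⁻ v in Set.Ioo 0 t, f t v) t =
      ∫⁻ v, Set.indicator {p : ℝ × ℝ | 0 < p.2 ∧ p.2 < p.1} (Function.uncurry f) (t, v) := by
    intro t
    simp only [← h1, ← lintegral_indicator measurableSet_Ioo]
    by_cases ht : t ∈ Set.Ioi (0 : ℝ) <;> simp [ht]
  have h4 : ∀ v, Set.indicator (Set.Ioi 0) (fun v => ∫⁻ t in Set.Ioi v, f t v) v =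
      ∫⁻ t, Set.indicator {p : ℝ × ℝ | 0 < p.2 ∧ p.2 < p.1} (Function.uncurry f) (t, v) := by
    intro v
    simp only [← h2, ← lintegral_indicator measurableSet_Ioi]
    by_cases hv : v ∈ Set.Ioi (0 : ℝ) <;> simp [hv]
  rw [← lintegral_indicator measurableSet_Ioi, ← lintegral_indicator measurableSet_Ioi]
  simp only [h3, h4]
  exact lintegral_lintegral_swap (hf.indicator hs).aemeasurable

/-! ### The Riesz potential of a power by subordination. -/

/-- The product of the subordination densities of `(1 + |y|²)^(-s)` and `|x - y|^(-2b)`. -/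
noncomputable def subordination (s b : ℝ) (x y : EuclideanSpace ℝ (Fin n)) (t u : ℝ) : ENNReal :=
  ENNReal.ofReal (t ^ (s - 1) * u ^ (b - 1) * Real.exp (-t) *
    Real.exp (-(u * ‖x - y‖ ^ 2 + t * ‖y‖ ^ 2)))

theorem lintegral_lintegral_subordination {s b : ℝ} (hs : 0 < s) (hb : 0 < b)
    {x y : EuclideanSpace ℝ (Fin n)} (hxy : y ≠ x) :
    ∫⁻ t in Set.Ioi (0 : ℝ), ∫⁻ u in Set.Ioi (0 : ℝ), subordination s b x y t u =
      ENNReal.ofReal (Real.Gamma s * Real.Gamma b) *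
        ENNReal.ofReal (bracketPow n (-s) y / ‖x - y‖ ^ (2 * b)) := by
  have h0 : 0 < ‖x - y‖ := norm_pos_iff.2 (sub_ne_zero.2 hxy.symm)
  have h1 : ∀ t ∈ Set.Ioi (0 : ℝ), ∫⁻ u in Set.Ioi (0 : ℝ), subordination s b x y t u =
      ENNReal.ofReal (t ^ (s - 1) * Real.exp (-((1 + ‖y‖ ^ 2) * t))) *
        ENNReal.ofReal (Real.Gamma b * (‖x - y‖ ^ 2) ^ (-b)) := by
    intro t ht
    have ht : 0 < t := ht
    rw [← lintegral_rpow_mul_exp_neg_mul hb (by positivity), ← lintegral_const_mul _ (by fun_prop)]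
    refine lintegral_congr fun u => ?_
    rw [← ENNReal.ofReal_mul (by positivity), subordination,
      show -(u * ‖x - y‖ ^ 2 + t * ‖y‖ ^ 2) = -(‖x - y‖ ^ 2 * u) + -(‖y‖ ^ 2 * t) by ring,
      show -((1 + ‖y‖ ^ 2) * t) = -t + -(‖y‖ ^ 2 * t) by ring, Real.exp_add, Real.exp_add]
    congr 1
    ring
  have h2 := Real.Gamma_pos_of_pos hs
  have h3 := Real.Gamma_pos_of_pos hb
  rw [setLIntegral_congr_fun measurableSet_Ioi h1, lintegral_mul_const _ (by fun_prop),
    lintegral_rpow_mul_exp_neg_mul hs (one_add_norm_sq_pos y),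
    ← ENNReal.ofReal_mul (by positivity), ← ENNReal.ofReal_mul (by positivity), bracketPow,
    Real.rpow_neg (by positivity) b, ← Real.rpow_natCast, ← Real.rpow_natCast,
    ← Real.rpow_mul h0.le, Nat.cast_ofNat]
  congr 1
  ring

theorem measurable_subordination (s b : ℝ) (x : EuclideanSpace ℝ (Fin n)) :
    Measurable fun p : (EuclideanSpace ℝ (Fin n) × ℝ) × ℝ =>
      subordination s b x p.1.1 p.1.2 p.2 := by
  unfold subordination
  fun_prop

theorem lintegral_subordination {s b t u : ℝ} (ht : 0 < t) (hu : 0 < u)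
    (x : EuclideanSpace ℝ (Fin n)) :
    ∫⁻ y, subordination s b x y t u =
      ENNReal.ofReal (Real.pi ^ ((n : ℝ) / 2) * (t ^ (s - 1) * Real.exp (-t))) *
        ENNReal.ofReal (u ^ (b - 1) * (u + t) ^ (-((n : ℝ) / 2)) *
          Real.exp (-(u * t / (u + t) * ‖x‖ ^ 2))) := by
  have hpi := Real.pi_pos
  have h1 : ∀ y, subordination s b x y t u =
      ENNReal.ofReal (t ^ (s - 1) * u ^ (b - 1) * Real.exp (-t)) *
        ENNReal.ofReal (Real.exp (-(u * ‖x - y‖ ^ 2 + t * ‖y‖ ^ 2))) := fun y => by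
    rw [← ENNReal.ofReal_mul (by positivity), subordination]
  simp only [h1]
  rw [lintegral_const_mul _ (by fun_prop), lintegral_gaussian_conv hu ht,
    ← ENNReal.ofReal_mul (by positivity), ← ENNReal.ofReal_mul (by positivity),
    Real.div_rpow hpi.le (by positivity), Real.rpow_neg (by positivity)]
  congr 1
  ring

theorem lintegral_bracketPow_mul_riesz {a b : ℝ} (ha : 0 < a) (hb : 0 < b)
    (hab : a + b = (n : ℝ) / 2) (j : ℕ) (x : EuclideanSpace ℝ (Fin n)) :
    ENNReal.ofReal (Real.Gamma (b + 2 * a + j) * Real.Gamma b) *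
      ∫⁻ y, ENNReal.ofReal (bracketPow n (-(b + 2 * a + j)) y / ‖x - y‖ ^ (2 * b)) =
      ENNReal.ofReal (Real.pi ^ ((n : ℝ) / 2) * ∑ i ∈ Finset.range (j + 1),
        j.choose i * rising a (j - i) * Real.Gamma a *
          (Real.Gamma (b + i) * (1 + ‖x‖ ^ 2) ^ (-(b + i)))) := by
  set s := b + 2 * a + j with hs
  have hs0 : 0 < s := by positivity
  have hn : 0 < n := by
    have : (0 : ℝ) < n := by linarith
    exact_mod_cast this
  have : Nonempty (Fin n) := ⟨⟨0, hn⟩⟩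
  have hpi : 0 < Real.pi ^ ((n : ℝ) / 2) := Real.rpow_pos_of_pos Real.pi_pos _
  have hm := measurable_subordination s b x
  have hΓ : 0 < Real.Gamma a := Real.Gamma_pos_of_pos ha
  calc
    _ = ∫⁻ y, ∫⁻ t in Set.Ioi (0 : ℝ), ∫⁻ u in Set.Ioi (0 : ℝ), subordination s b x y t u := by
      rw [← lintegral_const_mul' _ _ ENNReal.ofReal_ne_top]
      refine lintegral_congr_ae ?_
      -- At `y = x` the quotient is `0` by the division convention while the subordination integral
      -- diverges; points are null because `n > 0`.
      filter_upwards [Measure.ae_ne volume x] with y hy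
      rw [lintegral_lintegral_subordination hs0 hb hy]
    _ = ∫⁻ t in Set.Ioi (0 : ℝ), ∫⁻ u in Set.Ioi (0 : ℝ), ∫⁻ y, subordination s b x y t u := by
      rw [lintegral_lintegral_swap hm.lintegral_prod_right'.aemeasurable]
      refine lintegral_congr fun t => lintegral_lintegral_swap ?_
      have h1 : Measurable fun p : EuclideanSpace ℝ (Fin n) × ℝ => ((p.1, t), p.2) := by fun_prop
      exact (hm.comp h1).aemeasurable
    _ = ∫⁻ t in Set.Ioi (0 : ℝ), ∫⁻ v in Set.Ioo 0 t,
        ENNReal.ofReal (Real.pi ^ ((n : ℝ) / 2) * (v ^ (b - 1) * Real.exp (-(v * ‖x‖ ^ 2)))) *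
          ENNReal.ofReal (t ^ j * (t - v) ^ (a - 1) * Real.exp (-t)) := by
      refine setLIntegral_congr_fun measurableSet_Ioi fun t ht => ?_
      have ht : 0 < t := ht
      rw [setLIntegral_congr_fun measurableSet_Ioi
        (fun u hu => lintegral_subordination ht hu x), lintegral_const_mul _ (by fun_prop), ← hab,
        lintegral_mul_div_sub ht, hab, ← lintegral_const_mul _ (by fun_prop)]
      refine setLIntegral_congr_fun measurableSet_Ioo fun v hv => ?_
      obtain ⟨hv, hvt⟩ := hv
      -- The exponent `s = b + 2a + j` is exactly the one for which the total power of `t` is the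
      -- natural number `j`, so the binomial theorem applies afterwards.
      have h1 : t ^ j = t ^ (s - 1) * t ^ (1 - b - 2 * a) := by
        rw [← Real.rpow_add ht, ← Real.rpow_natCast]
        congr 1
        rw [hs]
        ring
      rw [← ENNReal.ofReal_mul (by positivity), ← ENNReal.ofReal_mul (by positivity), h1]
      congr 1
      ring
    _ = ∫⁻ v in Set.Ioi (0 : ℝ), ∫⁻ t in Set.Ioi v,
        ENNReal.ofReal (Real.pi ^ ((n : ℝ) / 2) * (v ^ (b - 1) * Real.exp (-(v * ‖x‖ ^ 2)))) *
          ENNReal.ofReal (t ^ j * (t - v) ^ (a - 1) * Real.exp (-t)) :=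
      lintegral_Ioi_Ioo_swap (by unfold Function.uncurry; fun_prop)
    _ = ∫⁻ v in Set.Ioi (0 : ℝ), ENNReal.ofReal (Real.pi ^ ((n : ℝ) / 2)) *
        ENNReal.ofReal (v ^ (b - 1) * Real.exp (-(v * ‖x‖ ^ 2)) *
          ∑ i ∈ Finset.range (j + 1), j.choose i * rising a (j - i) * Real.Gamma a *
            (v ^ i * Real.exp (-v))) := by
      refine setLIntegral_congr_fun measurableSet_Ioi fun v hv => ?_
      have hv : 0 < v := hv
      rw [lintegral_const_mul _ (by fun_prop), lintegral_pow_mul_exp_mul_sub_rpow ha hv,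
        ← ENNReal.ofReal_mul hpi.le, ← ENNReal.ofReal_mul (by positivity), mul_assoc]
    _ = _ := by
      rw [lintegral_const_mul _ (by fun_prop), lintegral_sum_pow_mul_exp hb (by positivity),
        ← ENNReal.ofReal_mul hpi.le]
      intro i
      have := rising_pos ha (j - i)
      positivity

theorem riesz_bracketPow {a b : ℝ} (ha : 0 < a) (hb : 0 < b)
    (hab : a + b = (n : ℝ) / 2) (j : ℕ) (x : EuclideanSpace ℝ (Fin n)) :
    Integrable (fun y => bracketPow n (-(b + 2 * a + j)) y / ‖x - y‖ ^ (2 * b)) ∧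
    ∫ y, bracketPow n (-(b + 2 * a + j)) y / ‖x - y‖ ^ (2 * b) =
      Real.pi ^ ((n : ℝ) / 2) * Real.Gamma a / (Real.Gamma (b + 2 * a + j) * Real.Gamma b) *
        ∑ i ∈ Finset.range (j + 1), j.choose i * rising a (j - i) *
          (Real.Gamma (b + i) * (1 + ‖x‖ ^ 2) ^ (-(b + i))) := by
  have h1 := lintegral_bracketPow_mul_riesz ha hb hab j x
  have hpi : 0 < Real.pi ^ ((n : ℝ) / 2) := Real.rpow_pos_of_pos Real.pi_pos _
  have h2 : 0 < Real.Gamma (b + 2 * a + j) * Real.Gamma b :=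
    mul_pos (Real.Gamma_pos_of_pos (by positivity)) (Real.Gamma_pos_of_pos hb)
  have h3 : 0 < Real.Gamma a := Real.Gamma_pos_of_pos ha
  have h4 : 0 ≤ ∑ i ∈ Finset.range (j + 1), j.choose i * rising a (j - i) * Real.Gamma a *
      (Real.Gamma (b + i) * (1 + ‖x‖ ^ 2) ^ (-(b + i))) := by
    refine Finset.sum_nonneg fun i _ => ?_
    have := rising_pos ha (j - i)
    have := Real.Gamma_pos_of_pos (show 0 < b + i by positivity)
    positivity
  have hm : Measurable fun y => bracketPow n (-(b + 2 * a + j)) y / ‖x - y‖ ^ (2 * b) := by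
    unfold bracketPow
    fun_prop
  have hnn : ∀ y, 0 ≤ bracketPow n (-(b + 2 * a + j)) y / ‖x - y‖ ^ (2 * b) := fun y => by
    unfold bracketPow
    positivity
  constructor
  · refine ⟨hm.aestronglyMeasurable, ?_⟩
    rw [hasFiniteIntegral_iff_ofReal (Filter.Eventually.of_forall hnn), lt_top_iff_ne_top]
    -- An infinite integral times a positive constant is infinite, whereas the computed right side
    -- is finite.
    intro h5
    rw [h5, ENNReal.mul_top (ENNReal.ofReal_pos.2 h2).ne'] at h1
    exact ENNReal.ofReal_ne_top h1.symm
  · rw [integral_eq_lintegral_of_nonneg_ae (Filter.Eventually.of_forall hnn)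
      hm.aestronglyMeasurable]
    have h5 := congrArg ENNReal.toReal h1
    rw [ENNReal.toReal_mul, ENNReal.toReal_ofReal h2.le, ENNReal.toReal_ofReal
      (mul_nonneg hpi.le h4)] at h5
    simp only [mul_right_comm _ (Real.Gamma a), ← Finset.sum_mul] at h5
    rw [div_mul_eq_mul_div, eq_div_iff h2.ne', mul_comm, h5]
    ring

/-! ### The integral of a power over the whole space. -/

theorem integral_bracketPow {s : ℝ} (hs : (n : ℝ) / 2 < s) :
    ∫ x, bracketPow n (-s) x =
      Real.pi ^ ((n : ℝ) / 2) * Real.Gamma (s - n / 2) / Real.Gamma s := by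
  have hn : (0 : ℝ) ≤ n := n.cast_nonneg
  have hs0 : 0 < s := by linarith
  have hpi : 0 < Real.pi ^ ((n : ℝ) / 2) := Real.rpow_pos_of_pos Real.pi_pos _
  have h2 : 0 < Real.Gamma s := Real.Gamma_pos_of_pos hs0
  have h3 : 0 < Real.Gamma (s - n / 2) := Real.Gamma_pos_of_pos (by linarith)
  have hm : Measurable (bracketPow n (-s)) := by
    unfold bracketPow
    fun_prop
  have hnn : ∀ y, 0 ≤ bracketPow n (-s) y := fun y => by
    unfold bracketPow
    positivity
  have h1 : ENNReal.ofReal (Real.Gamma s) * ∫⁻ y, ENNReal.ofReal (bracketPow n (-s) y) =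
      ENNReal.ofReal (Real.pi ^ ((n : ℝ) / 2) * Real.Gamma (s - n / 2)) := by
    calc
      _ = ∫⁻ y : EuclideanSpace ℝ (Fin n), ∫⁻ t in Set.Ioi (0 : ℝ),
          ENNReal.ofReal (t ^ (s - 1) * Real.exp (-((1 + ‖y‖ ^ 2) * t))) := by
        rw [← lintegral_const_mul' _ _ ENNReal.ofReal_ne_top]
        refine lintegral_congr fun y => ?_
        rw [lintegral_rpow_mul_exp_neg_mul hs0 (one_add_norm_sq_pos y),
          ← ENNReal.ofReal_mul h2.le, bracketPow]
      _ = ∫⁻ t in Set.Ioi (0 : ℝ), ∫⁻ y : EuclideanSpace ℝ (Fin n),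
          ENNReal.ofReal (t ^ (s - 1) * Real.exp (-((1 + ‖y‖ ^ 2) * t))) :=
        lintegral_lintegral_swap (by unfold Function.uncurry; fun_prop)
      _ = ∫⁻ t in Set.Ioi (0 : ℝ), ENNReal.ofReal (Real.pi ^ ((n : ℝ) / 2)) *
          ENNReal.ofReal (t ^ (s - n / 2 - 1) * Real.exp (-(1 * t))) := by
        refine setLIntegral_congr_fun measurableSet_Ioi fun t ht => ?_
        have ht : 0 < t := ht
        have h4 : ∀ y : EuclideanSpace ℝ (Fin n),
            ENNReal.ofReal (t ^ (s - 1) * Real.exp (-((1 + ‖y‖ ^ 2) * t))) =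
            ENNReal.ofReal (t ^ (s - 1) * Real.exp (-t)) *
              ENNReal.ofReal (Real.exp (-(t * ‖y - 0‖ ^ 2))) := fun y => by
          rw [← ENNReal.ofReal_mul (by positivity), mul_assoc, ← Real.exp_add, sub_zero]
          congr 3
          ring
        simp only [h4]
        rw [lintegral_const_mul _ (by fun_prop), lintegral_exp_neg_mul_norm_sub_sq ht,
          ← ENNReal.ofReal_mul (by positivity), ← ENNReal.ofReal_mul (by positivity),
          Real.div_rpow Real.pi_pos.le ht.le, sub_right_comm s, Real.rpow_sub ht (s - 1), one_mul]
        congr 1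
        ring
      _ = _ := by
        rw [lintegral_const_mul _ (by fun_prop),
          lintegral_rpow_mul_exp_neg_mul (by linarith) one_pos, ← ENNReal.ofReal_mul hpi.le,
          Real.one_rpow, mul_one]
  rw [integral_eq_lintegral_of_nonneg_ae (Filter.Eventually.of_forall hnn)
    hm.aestronglyMeasurable]
  have h5 := congrArg ENNReal.toReal h1
  rw [ENNReal.toReal_mul, ENNReal.toReal_ofReal h2.le, ENNReal.toReal_ofReal
    (mul_nonneg hpi.le h3.le)] at h5
  rw [eq_div_iff h2.ne', mul_comm, h5]

/-! ### The potential `h`, its integral and its nonvanishing. -/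

theorem rieszIntegrand_w (m : ℕ) (α : ℝ) (x : EuclideanSpace ℝ (Fin n)) :
    rieszIntegrand α (w n m α) x = fun y => ∑ j ∈ Finset.range (m + 1), wCoeff n m α j *
      (bracketPow n (-((n - α) / 2 + 2 * (α / 2) + j)) y / ‖x - y‖ ^ (2 * ((n - α) / 2))) := by
  ext y
  rw [rieszIntegrand, w_eq_sum, Finset.sum_div]
  refine Finset.sum_congr rfl fun j _ => ?_
  rw [mul_div_assoc, show ((n : ℝ) - α) / 2 + 2 * (α / 2) + j = (n + α) / 2 + j by ring,
    show 2 * (((n : ℝ) - α) / 2) = n - α by ring]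

theorem rieszIntegrand_w_integrable (m : ℕ) {α : ℝ} (hα : 0 < α) (hn : α < n)
    (x : EuclideanSpace ℝ (Fin n)) : Integrable (rieszIntegrand α (w n m α) x) volume := by
  rw [rieszIntegrand_w]
  exact integrable_finsetSum _ fun j _ => (riesz_bracketPow (by linarith) (by linarith)
    (by ring) j x).1.const_mul _

theorem integral_rieszIntegrand_w (m : ℕ) {α : ℝ} (hα : 0 < α) (hn : α < n)
    (x : EuclideanSpace ℝ (Fin n)) :
    ∫ y, rieszIntegrand α (w n m α) x y =
      4 ^ m * Real.pi ^ ((n : ℝ) / 2) * Real.Gamma (α / 2) / Real.Gamma ((n - α) / 2) *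
        (1 / Real.Gamma ((n + α) / 2 - m)) * (Real.Gamma ((n - α) / 2 + m) *
          (1 + ‖x‖ ^ 2) ^ (-((n - α) / 2 + m))) := by
  have ha : 0 < α / 2 := by linarith
  have hb : 0 < ((n : ℝ) - α) / 2 := by linarith
  have hab : α / 2 + ((n : ℝ) - α) / 2 = n / 2 := by ring
  rw [rieszIntegrand_w, integral_finsetSum _ fun j _ =>
    (riesz_bracketPow ha hb hab j x).1.const_mul _]
  simp only [integral_const_mul, (riesz_bracketPow ha hb hab _ x).2]
  set X : ℕ → ℝ := fun i => Real.Gamma ((n - α) / 2 + i) *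
    (1 + ‖x‖ ^ 2) ^ (-((n - α) / 2 + i)) with hX
  -- This factor `((n + α)/2 - m)_m / Γ((n + α)/2)` is common to all terms: in `wCoeff` the rising
  -- factorial of length `m + j` splits, and its tail `((n + α)/2)_j` cancels against `Γ((n + α)/2 +
  -- j)`.
  rw [← rising_div_Gamma _ m]
  change _ = _ * X m
  rw [← sum_rising_inversion (α / 2) X m, Finset.mul_sum]
  refine Finset.sum_congr rfl fun j _ => ?_
  have h1 : ((n : ℝ) - α) / 2 + 2 * (α / 2) + j = (n + α) / 2 - m + m + j := by ring
  have h2 : (0 : ℝ) < (n + α) / 2 - m + m := by linarith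
  have h3 := (Real.Gamma_pos_of_pos h2).ne'
  have h4 := (rising_pos h2 j).ne'
  rw [h1, Gamma_add_nat h2, wCoeff, rising_add]
  generalize rising ((n + α) / 2 - m + m) j = r at h4 ⊢
  generalize Real.Gamma ((n + α) / 2 - m + m) = g at h3 ⊢
  change _ * (_ * ∑ i ∈ Finset.range (j + 1), (j.choose i * rising (α / 2) (j - i)) * X i) = _
  generalize ∑ i ∈ Finset.range (j + 1), (j.choose i * rising (α / 2) (j - i)) * X i = S
  generalize Real.Gamma (((n : ℝ) - α) / 2) = g'
  field_simp

theorem h_eq (m : ℕ) {α : ℝ} (hα : 0 < α) (hn : α < n) (x : EuclideanSpace ℝ (Fin n)) :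
    h n m α x = aConst n m α * (1 + ‖x‖ ^ 2) ^ ((α - (n : ℝ)) / 2 - (m : ℝ)) := by
  have h1 := (Real.Gamma_pos_of_pos (show 0 < α / 2 by linarith)).ne'
  have h2 := (Real.Gamma_pos_of_pos (show 0 < ((n : ℝ) - α) / 2 by linarith)).ne'
  have h3 := (Real.rpow_pos_of_pos Real.pi_pos ((n : ℝ) / 2)).ne'
  have h4 := (Real.rpow_pos_of_pos two_pos α).ne'
  have h5 : (2 : ℝ) ^ (2 * (m : ℝ) - α) = 4 ^ m / 2 ^ α := by
    rw [Real.rpow_sub two_pos, Real.rpow_mul two_pos.le, Real.rpow_natCast]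
    norm_num
  rw [h, rieszPotential, integral_rieszIntegrand_w m hα hn, aConst, gammaConst, h5,
    show ((n : ℝ) + α - 2 * m) / 2 = (n + α) / 2 - m by ring,
    show ((n : ℝ) + 2 * m - α) / 2 = (n - α) / 2 + m by ring,
    show (α - (n : ℝ)) / 2 - m = -((n - α) / 2 + m) by ring]
  field_simp

theorem h_eq_bracketPow (m : ℕ) {α : ℝ} (hα : 0 < α) (hn : α < n) :
    h n m α = fun x => aConst n m α * bracketPow n (-(((n : ℝ) + 2 * m - α) / 2)) x := by
  ext x
  rw [h_eq m hα hn, bracketPow]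
  congr 2
  ring

theorem h_integrable (m : ℕ) {α : ℝ} (hα : 0 < α) (hn : α < n) (hm : α < 2 * m) :
    Integrable (h n m α) volume := by
  rw [h_eq_bracketPow m hα hn]
  exact (bracketPow_integrable (by linarith)).const_mul _

theorem cConst_eq (m : ℕ) {α : ℝ} (hα : 0 < α) (hn : α < n) (hm : α < 2 * m) :
    cConst n m α = 2 ^ (2 * (m : ℝ) - α) * Real.pi ^ ((n : ℝ) / 2) *
      Real.Gamma ((m : ℝ) - α / 2) / Real.Gamma (((n : ℝ) + α - 2 * m) / 2) := by
  have h1 := (Real.Gamma_pos_of_pos (show 0 < ((n : ℝ) + 2 * m - α) / 2 by linarith)).ne'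
  rw [cConst, h_eq_bracketPow m hα hn, integral_const_mul, integral_bracketPow (by linarith),
    aConst, show ((n : ℝ) + 2 * m - α) / 2 - n / 2 = m - α / 2 by ring]
  field_simp

theorem cConst_ne_zero (m : ℕ) {α : ℝ} (hα : 0 < α) (hn : α < n) (hm : α < 2 * m)
    (hpole : ∀ k : ℕ, ((n : ℝ) + α - 2 * m) / 2 ≠ -k) : cConst n m α ≠ 0 := by
  have h1 := (Real.Gamma_pos_of_pos (show 0 < (m : ℝ) - α / 2 by linarith)).ne'
  have h2 := (Real.rpow_pos_of_pos Real.pi_pos ((n : ℝ) / 2)).ne'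
  have h3 := (Real.rpow_pos_of_pos two_pos (2 * (m : ℝ) - α)).ne'
  have h4 := Real.Gamma_ne_zero hpole
  rw [cConst_eq m hα hn hm]
  positivity

end RieszInversion

theorem lemma3p2 (n : ℕ) :
    -- `w` belongs to `L¹`
    (∀ (m : ℕ) (α : ℝ), 0 < α → Integrable (RieszInversion.w n m α) volume) ∧
    -- the Riesz potential of `w` converges everywhere, its value, its integral
    (∀ (m : ℕ) (α : ℝ), 0 < α → α < min (n : ℝ) (2 * m) →
      (∀ x : EuclideanSpace ℝ (Fin n),
        Integrable (RieszInversion.rieszIntegrand α (RieszInversion.w n m α) x) volume) ∧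
      (∀ x : EuclideanSpace ℝ (Fin n),
        RieszInversion.h n m α x =
          RieszInversion.aConst n m α * (1 + ‖x‖ ^ 2) ^ ((α - (n : ℝ)) / 2 - (m : ℝ))) ∧
      Integrable (RieszInversion.h n m α) volume ∧
      RieszInversion.cConst n m α =
        2 ^ (2 * (m : ℝ) - α) * Real.pi ^ ((n : ℝ) / 2) * Real.Gamma ((m : ℝ) - α / 2) /
          Real.Gamma (((n : ℝ) + α - 2 * m) / 2) ∧
      RieszInversion.cConst n m α = RieszInversion.gammaConst n (2 * (m : ℝ) - α)) ∧
    -- non-integer `α`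
    (∀ α : ℝ, 0 < α → α < n → (∀ k : ℤ, α ≠ k) →
      ∀ m : ℕ, α / 2 < m → RieszInversion.cConst n m α ≠ 0) ∧
    -- integer `α = k` in `{1, …, n - 1}` and `m = [(k + 2)/2]`; this `m` satisfies `k < 2m`
    (∀ k : ℕ, 1 ≤ k → k < n →
      k < 2 * ((k + 2) / 2) ∧ RieszInversion.cConst n ((k + 2) / 2) (k : ℝ) ≠ 0) := by
  open RieszInversion in
  refine ⟨fun m α hα => w_integrable m hα, fun m α hα hmin => ?_, fun α hα hn hk m hm => ?_,
    fun k hk hkn => ?_⟩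
  · obtain ⟨hn, hm⟩ := lt_min_iff.1 hmin
    refine ⟨rieszIntegrand_w_integrable m hα hn, h_eq m hα hn, h_integrable m hα hn hm,
      cConst_eq m hα hn hm, ?_⟩
    rw [cConst_eq m hα hn hm, gammaConst, show (2 * (m : ℝ) - α) / 2 = m - α / 2 by ring,
      sub_sub_eq_add_sub]
  -- A pole at `-l` would force `α = 2m - n - 2l`, an integer.
  · refine cConst_ne_zero m hα hn (by linarith) fun l hl => hk (2 * m - n - 2 * l) ?_
    push_cast
    linarith
  · have h1 : k < 2 * ((k + 2) / 2) := by omega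
    -- Clear for `n ≥ 3`; for `n = 2`, `k = 1` the floor gives `2m = k + 1`. Hence the Gamma
    -- argument `(n + k - 2m)/2` is positive and is not a pole.
    have h2 : 2 * ((k + 2) / 2) < n + k := by omega
    have h3 : (k : ℝ) < 2 * ((k + 2) / 2 : ℕ) := by exact_mod_cast h1
    have h4 : 2 * (((k + 2) / 2 : ℕ) : ℝ) < n + k := by exact_mod_cast h2
    refine ⟨h1, cConst_ne_zero _ (by exact_mod_cast hk) (by exact_mod_cast hkn) h3
      fun l hl => ?_⟩
    have : (0 : ℝ) ≤ l := l.cast_nonneg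
    linarith
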